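/- Let $q=2^e$ with $e\ge 1$, let $\mathrm{Tr}$ be the absolute trace $\mathbb F_q\to\mathbb F_2$, let $g$ be a generator of $\mathbb F_q^*$, let $h$ be a proper divisor of $e$ such that $e/h$ is even, and put $m=e/2$. For $a\in\mathbb F_q^*$ let $$D=D_{(a,0)}=\{(x,y)\in\mathbb F_q^2\setminus\{(0,0)\}:\mathrm{Tr}(ax^{2^h+1})=0\},\qquad \mathcal C_D=\{(\mathrm{Tr}(ux+vy))_{(x,y)\in D}:(u,v)\in\mathbb F_q^2\}\subseteq\mathbb F_2^{D}.$$ For an integer $\omega\ge 0$ let $A_\omega$ be the number of codewords of $\mathcal C_D$ of Hamming weight $\omega$. (i) If $a\notin\langle g^{2^h+1}\rangle$, then $\mathcal C_D$ has length $n=|D|=\frac12q\left(q+(-1)^{m/h}2^m\right)-1$. If moreover $e\ne 2$, then $\mathcal C_D$ has dimension $2e$ over $\mathbb F_2$ and its weight distribution is | weight $\omega$ | multiplicity $A_\omega$ | |---|---| | $0$ | $1$ | | $\frac14q\left(q+(-1)^{m/h}2^m\right)$ | $q(q-1)$ | | $\frac14q^2$ | $\frac12q+(-1)^{m/h}2^{m-1}-1$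 | | $\frac14q\left(q+(-1)^{m/h}2^{m+1}\right)$ | $\frac12q-(-1)^{m/h}2^{m-1}$ | with $A_\omega=0$ for every other $\omega$. (ii) If $a\in\langle g^{2^h+1}\rangle$, then $\mathcal C_D$ has length $n=|D|=\frac12q\left(q-(-1)^{m/h}2^{m+h}\right)-1$. If moreover $(e,h)\ne(4,1)$, then $\mathcal C_D$ has dimension $2e$ over $\mathbb F_2$ and its weight distribution is | weight $\omega$ | multiplicity $A_\omega$ | |---|---| | $0$ | $1$ | | $\frac14q\left(q-(-1)^{m/h}2^{m+h}\right)$ | $q^2-2^{e-2h}$ | | $\frac14q^2$ | $2^{e-2h-1}-(-1)^{m/h}2^{m-h-1}-1$ | | $\frac14q\left(q-(-1)^{m/h}2^{m+h+1}\right)$ | $2^{e-2h-1}+(-1)^{m/h}2^{m-h-1}$ | with $A_\omega=0$ for every other $\omega$. (If $e=2h$, the last two multiplicities are $0$.) -/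

import Mathlib

/-- The set `D_(a,b)` of all nonzero `(x, y)` in `K × K` with `Tr (a x^(2^h+1) + b y) = 0`, where
`Tr` is the absolute trace of the finite field `K` of characteristic two. -/
noncomputable def definingSet {K : Type*} [Field K] [Fintype K] [Algebra (ZMod 2) K]
    (h : ℕ) (a b : K) : Finset (K × K) :=
  open Classical in
  Finset.univ.filter fun p =>
    p ≠ 0 ∧ Algebra.trace (ZMod 2) K (a * p.1 ^ (2 ^ h + 1) + b * p.2) = 0

/-- The map sending `(u, v)` to the codeword `(Tr (u x + v y))`, with coordinates indexed by the
points `(x, y)` of `D`. -/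
noncomputable def codeword {K : Type*} [Field K] [Algebra (ZMod 2) K] (D : Finset (K × K)) :
    (K × K) →ₗ[ZMod 2] (D → ZMod 2) where
  toFun u d := Algebra.trace (ZMod 2) K (u.1 * d.1.1 + u.2 * d.1.2)
  map_add' u v := by
    funext d
    simp only [Pi.add_apply, Prod.fst_add, Prod.snd_add, ← map_add]
    congr 1
    ring
  map_smul' c u := by
    funext d
    simp only [Pi.smul_apply, Prod.smul_fst, Prod.smul_snd, RingHom.id_apply, ← map_smul,
      smul_add, smul_mul_assoc]

/-- The binary linear code with defining set `D`; its length is the number of points of `D`. -/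
noncomputable def definingSetCode {K : Type*} [Field K] [Algebra (ZMod 2) K]
    (D : Finset (K × K)) : Submodule (ZMod 2) (D → ZMod 2) :=
  LinearMap.range (codeword D)

/-- The number of codewords of Hamming weight `w` in a binary linear code. -/
noncomputable def weightMultiplicity {ι : Type*} [Fintype ι]
    (C : Submodule (ZMod 2) (ι → ZMod 2)) (w : ℕ) : ℕ :=
  Set.ncard {c : ι → ZMod 2 | c ∈ C ∧ hammingNorm c = w}

/-- The code `C` has the weight distribution of the table `T`, a list of rows
(weight, multiplicity): in each row the first entry is a natural number and the second is the number
of codewords of that weight, and no codeword has a weight that is not listed. -/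
def HasWeightDistribution {ι : Type*} [Fintype ι]
    (C : Submodule (ZMod 2) (ι → ZMod 2)) (T : List (ℚ × ℚ)) : Prop :=
  (∀ r ∈ T, ∃ w : ℕ, (w : ℚ) = r.1 ∧ (weightMultiplicity C w : ℚ) = r.2) ∧
    ∀ w : ℕ, (∀ r ∈ T, (w : ℚ) ≠ r.1) → weightMultiplicity C w = 0

/-!
Write `q = 2 ^ e`, `e = 2 h k`, `m = h k`, `N = 2 ^ h + 1`, and let `ψ x = (-1) ^ Tr x`. Everything
reduces to the sums `S u = ∑ x, ψ (a x ^ N + u x)` (`weilSum h a u`). Expanding indicator functions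
in `ψ` gives `2 (|D| + 1) = q (q + S 0)` and, for the weight of the codeword of `(u, v)`,
`4 wt = q (q + S 0) - [v = 0] q (q [u = 0] + S u)` (`four_mul_hammingNorm_codeword`).

The function `Tr (a x ^ N)` is a quadratic form, so `S u ^ 2` is `q` times a character sum over its
radical `{z | a z = a ^ (2 ^ h) z ^ (2 ^ (2 h))}` (`weilSum_sq`). The radical is zero if `a` is not
an `N`-th power, and then `S u ^ 2 = q` for all `u`. If `a = b ^ N`, a substitution reduces to
`a = 1`, where the radical is the subfield with `2 ^ (2 h)` elements and the form vanishes on it,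
so that `S u ^ 2` is `0` or `q 2 ^ (2 h)`, the latter for `u = 0`.

The sign of `S 0` comes from a congruence: `N ∣ q - 1`, so `x ↦ x ^ N` is `N`-to-one on `Kˣ` and
`S 0 ≡ 1` modulo `N`, whereas `2 ^ (h j) ≡ (-1) ^ j`, and `1 ≢ -1` since `N ≥ 3` is odd
(`eq_neg_one_pow_mul`). This gives `S 0 = (-1) ^ k 2 ^ m`, respectively
`S 0 = -(-1) ^ k 2 ^ (m + h)`.

With `s = S 0`, in both cases `S u ∈ {0, s, -s}`. The moments `∑ S u = q` and `∑ S u ^ 2 = q ^ 2`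
show that `s` and `-s` are taken `(t ^ 2 + t) / 2` and `(t ^ 2 - t) / 2` times, where `t = q / s`
(`card_weilSum_eq`). As long as `q + 2 s > 0`, which is where the two small exceptions come from, no
nonzero pair `(u, v)` has weight zero, and both tables are instances of
`weightDistribution_of_weilSum`.
-/

/-! ### The quadratic character sums -/

section CharacterSums

variable {K : Type*} [Field K] [Algebra (ZMod 2) K]

variable (K) in
/-- The additive character `x ↦ (-1) ^ Tr x`, with values in `ℤ`. -/
noncomputable def traceChar : AddChar K ℤ where
  toFun x := if Algebra.trace (ZMod 2) K x = 0 then 1 else -1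
  map_zero_eq_one' := by simp
  map_add_eq_mul' x y := by
    rw [map_add]
    generalize Algebra.trace (ZMod 2) K x = s
    generalize Algebra.trace (ZMod 2) K y = t
    revert s t
    decide

lemma traceChar_apply (x : K) :
    traceChar K x = if Algebra.trace (ZMod 2) K x = 0 then 1 else -1 := rfl

lemma traceChar_mul_self (x : K) : traceChar K x * traceChar K x = 1 := by
  rw [traceChar_apply]; split_ifs <;> rfl

variable (K) in
lemma charP_two_of_algebra : CharP K 2 :=
  charP_of_injective_algebraMap (algebraMap (ZMod 2) K).injective 2

variable [Fintype K]

lemma trace_pow_two_pow (x : K) (n : ℕ) :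
    Algebra.trace (ZMod 2) K (x ^ 2 ^ n) = Algebra.trace (ZMod 2) K x := by
  induction n with
  | zero => simp
  | succ n ih =>
    rw [pow_succ, pow_mul, ← ih]
    have := Algebra.trace_eq_of_algEquiv
      (FiniteField.frobeniusAlgEquivOfAlgebraic (ZMod 2) K) (x ^ 2 ^ n)
    simpa [ZMod.card] using this

lemma traceChar_pow_two_pow (x : K) (n : ℕ) : traceChar K (x ^ 2 ^ n) = traceChar K x := by
  rw [traceChar_apply, traceChar_apply, trace_pow_two_pow]

lemma sum_traceChar_mul [DecidableEq K] (c : K) :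
    ∑ x, traceChar K (c * x) = if c = 0 then (Fintype.card K : ℤ) else 0 := by
  split_ifs with hc
  · simp [hc]
  · have h := AddChar.sum_eq_ite ((traceChar K).mulShift c)
    simp only [AddChar.mulShift_apply] at h
    rw [h, if_neg]
    intro h0
    refine hc ((traceForm_nondegenerate (ZMod 2) K).1 c fun x => ?_)
    have := DFunLike.congr_fun h0 x
    rw [AddChar.mulShift_apply, traceChar_apply] at this
    by_contra hne
    rw [Algebra.traceForm_apply] at hne
    simp [hne] at this

/-- The exponential sum `∑ x, (-1) ^ Tr (a x ^ (2 ^ h + 1) + u x)`. -/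
noncomputable def weilSum (h : ℕ) (a u : K) : ℤ :=
  ∑ x, traceChar K (a * x ^ (2 ^ h + 1) + u * x)

/-- First moment: only `x = 0` survives the summation over `u`. -/
lemma sum_weilSum (h : ℕ) (a : K) : ∑ u, weilSum h a u = Fintype.card K := by
  classical
  simp only [weilSum, AddChar.map_add_eq_mul]
  rw [Finset.sum_comm]
  simp only [← Finset.mul_sum, mul_comm _ (_ : K), sum_traceChar_mul]
  simp

/-- The inner sum of a squared `weilSum`: the polarisation of the quadratic form
`Tr (a x ^ (2 ^ h + 1))` is made linear in `x ^ 2 ^ h` by the Frobenius invariance of the trace. -/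
lemma sum_traceChar_polar [DecidableEq K] (h : ℕ) (a z : K) :
    ∑ x, traceChar K (a * (x ^ 2 ^ h * z + x * z ^ 2 ^ h)) =
      if a * z = a ^ 2 ^ h * z ^ 2 ^ (2 * h) then (Fintype.card K : ℤ) else 0 := by
  have := charP_two_of_algebra K
  have key (x : K) : traceChar K (a * (x ^ 2 ^ h * z + x * z ^ 2 ^ h)) =
      traceChar K ((a * z + a ^ 2 ^ h * z ^ 2 ^ (2 * h)) * iterateFrobeniusEquiv K 2 h x) := by
    rw [mul_add, AddChar.map_add_eq_mul, ← traceChar_pow_two_pow (a * (x * z ^ 2 ^ h)) h,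
      ← AddChar.map_add_eq_mul, iterateFrobeniusEquiv_def, two_mul h, pow_add 2 h h, pow_mul]
    ring_nf
  simp only [key]
  refine (Equiv.sum_comp (iterateFrobeniusEquiv K 2 h).toEquiv
    (fun y => traceChar K ((a * z + a ^ 2 ^ h * z ^ 2 ^ (2 * h)) * y))).trans ?_
  simp only [sum_traceChar_mul, CharTwo.add_eq_zero]

/-- Substituting `y = x + z` in the double sum, the square of a `weilSum` is `q` times a character
sum over the radical of the quadratic form `Tr (a x ^ (2 ^ h + 1))`. -/
lemma weilSum_sq [DecidableEq K] (h : ℕ) (a u : K) :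
    weilSum h a u ^ 2 = Fintype.card K *
      ∑ z with a * z = a ^ 2 ^ h * z ^ 2 ^ (2 * h),
        traceChar K (a * z ^ (2 ^ h + 1) + u * z) := by
  have := charP_two_of_algebra K
  have key (x z : K) : traceChar K (a * x ^ (2 ^ h + 1) + u * x) *
      traceChar K (a * (x + z) ^ (2 ^ h + 1) + u * (x + z)) =
      traceChar K (a * z ^ (2 ^ h + 1) + u * z) *
        traceChar K (a * (x ^ 2 ^ h * z + x * z ^ 2 ^ h)) := by
    have e : a * (x + z) ^ (2 ^ h + 1) + u * (x + z) =
        (a * x ^ (2 ^ h + 1) + u * x) + ((a * z ^ (2 ^ h + 1) + u * z) +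
          a * (x ^ 2 ^ h * z + x * z ^ 2 ^ h)) := by
      rw [pow_succ (x + z), add_pow_char_pow]; ring
    rw [e, AddChar.map_add_eq_mul _ (a * x ^ (2 ^ h + 1) + u * x), ← mul_assoc,
      traceChar_mul_self, one_mul, AddChar.map_add_eq_mul]
  calc weilSum h a u ^ 2
      = ∑ x, ∑ z, traceChar K (a * x ^ (2 ^ h + 1) + u * x) *
          traceChar K (a * (x + z) ^ (2 ^ h + 1) + u * (x + z)) := by
        rw [sq, weilSum, Finset.sum_mul]
        refine Finset.sum_congr rfl fun x _ => ?_
        rw [Finset.mul_sum]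
        exact (Equiv.sum_comp (Equiv.addLeft x) fun y =>
          traceChar K (a * x ^ (2 ^ h + 1) + u * x) *
            traceChar K (a * y ^ (2 ^ h + 1) + u * y)).symm
    _ = _ := by
        simp only [key]
        rw [Finset.sum_comm]
        simp only [← Finset.mul_sum, sum_traceChar_polar, Finset.sum_filter]
        rw [Finset.mul_sum]
        refine Finset.sum_congr rfl fun z _ => ?_
        split_ifs <;> ring

/-- Second moment: only `z = 0` in the radical survives the summation over `u`. -/
lemma sum_weilSum_sq (h : ℕ) (a : K) : ∑ u, weilSum h a u ^ 2 = (Fintype.card K : ℤ) ^ 2 := by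
  classical
  simp only [weilSum_sq, AddChar.map_add_eq_mul]
  rw [← Finset.mul_sum, Finset.sum_comm]
  simp only [← Finset.mul_sum, mul_comm _ (_ : K), sum_traceChar_mul]
  simp [sq]

lemma weilSum_pow_mul (h : ℕ) {b : K} (hb : b ≠ 0) (a u : K) :
    weilSum h (a * b ^ (2 ^ h + 1)) u = weilSum h a (u / b) := by
  rw [weilSum, weilSum, eq_comm, ← Equiv.sum_comp (Equiv.mulLeft₀ b hb)]
  refine Finset.sum_congr rfl fun x _ => ?_
  rw [Equiv.mulLeft₀_apply]
  congr 1
  field_simp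
  ring

end CharacterSums

/-! ### Powers in the unit group -/

section Units

lemma two_pow_sub_one_dvd {e h k : ℕ} (he : e = h * (2 * k)) : 2 ^ (2 * h) - 1 ∣ 2 ^ e - 1 :=
  Nat.pow_sub_one_dvd_pow_sub_one 2 ⟨k, by rw [he]; ring⟩

lemma two_pow_add_one_dvd {e h k : ℕ} (he : e = h * (2 * k)) : 2 ^ h + 1 ∣ 2 ^ e - 1 := by
  refine Dvd.dvd.trans ⟨2 ^ h - 1, ?_⟩ (two_pow_sub_one_dvd he)
  rw [← Nat.sq_sub_sq, one_pow, ← pow_mul, mul_comm]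

variable {K : Type*} [Field K] [Fintype K]

lemma sum_eq_zero_add_sum_units [Fintype Kˣ] {M : Type*} [AddCommMonoid M] (f : K → M) :
    ∑ x, f x = f 0 + ∑ x : Kˣ, f x := by
  classical
  rw [Fintype.sum_eq_add_sum_subtype_ne f 0, ← Equiv.sum_comp unitsEquivNeZero]
  rfl

lemma card_pow_fiber_eq [Fintype Kˣ] [DecidableEq Kˣ] {n : ℕ} (hn : n ∣ Fintype.card K - 1)
    (x : Kˣ) : (Finset.univ.filter fun y : Kˣ => y ^ n = x ^ n).card = n := by
  have h := MonoidHom.card_fiber_eq_of_mem_range (powMonoidHom n : Kˣ →* Kˣ)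
    (x := x ^ n) (y := 1) ⟨x, rfl⟩ ⟨1, one_pow n⟩
  simp only [powMonoidHom_apply] at h
  rw [h]
  have h2 := IsCyclic.card_powMonoidHom_ker (G := Kˣ) n
  rw [Nat.card_units, Nat.card_eq_fintype_card (α := K), Nat.gcd_eq_right hn] at h2
  rw [← Fintype.card_subtype, ← Nat.card_eq_fintype_card]
  exact h2

/-- The map `x ↦ x ^ n` has all nonempty fibres on `Kˣ` of size `n`. -/
lemma dvd_sum_units_pow [Fintype Kˣ] {n : ℕ} (hn : n ∣ Fintype.card K - 1) (f : Kˣ → ℤ) :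
    (n : ℤ) ∣ ∑ x : Kˣ, f (x ^ n) := by
  classical
  rw [Finset.sum_comp f fun x : Kˣ => x ^ n]
  refine Finset.dvd_sum fun y hy => ?_
  obtain ⟨x, -, rfl⟩ := Finset.mem_image.1 hy
  rw [card_pow_fiber_eq hn, nsmul_eq_mul]
  exact dvd_mul_right _ _

lemma card_pow_eq_self {n : ℕ} (hn : n + 1 ∣ Fintype.card K - 1) [DecidableEq K] :
    (Finset.univ.filter fun x : K => x ^ (n + 2) = x).card = n + 2 := by
  classical
  rw [Finset.card_filter, sum_eq_zero_add_sum_units, ← Finset.card_filter]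
  have h : ∀ x : Kˣ, (x : K) ^ (n + 2) = x ↔ x ^ (n + 1) = 1 ^ (n + 1) := fun x => by
    rw [one_pow, ← Units.val_pow_eq_pow_val, Units.val_inj, pow_succ, mul_eq_right]
  simp only [h, card_pow_fiber_eq hn 1]
  simp only [ne_eq, Nat.add_eq_zero_iff, OfNat.ofNat_ne_zero, and_false, not_false_eq_true,
    zero_pow, if_true]
  omega

lemma card_radical {e h k : ℕ} (hh : 0 < h) (hK : Fintype.card K = 2 ^ e)
    (he : e = h * (2 * k)) [DecidableEq K] :
    (Finset.univ.filter fun z : K => z ^ 2 ^ (2 * h) = z).card = 2 ^ (2 * h) := by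
  have h2 : 2 ≤ 2 ^ (2 * h) := Nat.le_self_pow (by omega) 2
  obtain ⟨n, hn⟩ := Nat.exists_eq_add_of_le' h2
  have hd := two_pow_sub_one_dvd he
  rw [← hK, hn] at hd
  rw [hn]
  exact card_pow_eq_self hd

end Units

/-! ### The square and the sign of the sums -/

section SignedValues

variable {K : Type*} [Field K] [Fintype K] [Algebra (ZMod 2) K]

/-- The nonzero terms of `weilSum h a 0` are constant on the fibres of `x ↦ x ^ (2 ^ h + 1)`. -/
lemma dvd_weilSum_zero_sub_one {h : ℕ} (hd : 2 ^ h + 1 ∣ Fintype.card K - 1) (a : K) :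
    ((2 ^ h + 1 : ℕ) : ℤ) ∣ weilSum h a 0 - 1 := by
  classical
  have := dvd_sum_units_pow hd fun y : Kˣ => traceChar K (a * y)
  rw [weilSum, sum_eq_zero_add_sum_units]
  simpa using this

/-- The radical of `Tr (a x ^ (2 ^ h + 1))` is trivial unless `a` is a `(2 ^ h + 1)`-st power:
for `z ≠ 0` in the radical, `a z ^ (2 ^ h + 1)` is fixed by `x ↦ x ^ 2 ^ h`, and then its square
root is a `(2 ^ h + 1)`-st root of it. -/
lemma eq_zero_of_mem_radical {h : ℕ} {a z : K} (ha : ∀ b : K, a ≠ b ^ (2 ^ h + 1))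
    (hz : a * z = a ^ 2 ^ h * z ^ 2 ^ (2 * h)) : z = 0 := by
  have := charP_two_of_algebra K
  by_contra h0
  obtain ⟨d, hd⟩ := (frobeniusEquiv K 2).surjective (a * z ^ (2 ^ h + 1))
  rw [frobeniusEquiv_apply, frobenius_def] at hd
  have hc : (a * z ^ (2 ^ h + 1)) ^ 2 ^ h = a * z ^ (2 ^ h + 1) := by
    have e : (z ^ 2 ^ h) ^ 2 ^ h = z ^ 2 ^ (2 * h) := by rw [← pow_mul, ← pow_add, two_mul]
    rw [mul_pow, pow_succ z, mul_pow, e, ← mul_assoc, ← hz]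
    ring
  have hdd : d ^ 2 ^ h = d := by
    apply (frobeniusEquiv K 2).injective
    rw [frobeniusEquiv_apply, frobeniusEquiv_apply, frobenius_def, frobenius_def, ← pow_mul,
      mul_comm, pow_mul, hd, hc]
  apply ha (d / z)
  rw [div_pow, eq_div_iff (pow_ne_zero _ h0), ← hd, pow_succ d (2 ^ h), hdd, sq]

lemma weilSum_sq_of_not_pow {h : ℕ} {a : K} (ha : ∀ b : K, a ≠ b ^ (2 ^ h + 1)) (u : K) :
    weilSum h a u ^ 2 = Fintype.card K := by
  classical
  have hr : (Finset.univ.filter fun z : K => a * z = a ^ 2 ^ h * z ^ 2 ^ (2 * h)) = {0} := by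
    ext z
    simp only [Finset.mem_filter, Finset.mem_univ, true_and, Finset.mem_singleton]
    exact ⟨eq_zero_of_mem_radical ha, fun hz => by simp [hz]⟩
  rw [weilSum_sq, hr]
  simp

/-- An element of the subfield with `2 ^ h` elements has absolute trace zero when the degree over
that subfield is even. -/
lemma trace_eq_zero_of_pow_eq_self {e h k : ℕ} (hK : Fintype.card K = 2 ^ e)
    (he : e = h * (2 * k)) {c : K} (hc : c ^ 2 ^ h = c) : Algebra.trace (ZMod 2) K c = 0 := by
  have := charP_two_of_algebra K
  apply (algebraMap (ZMod 2) K).injective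
  have hf : Module.finrank (ZMod 2) K = e := by
    have := Module.card_eq_pow_finrank (K := ZMod 2) (V := K)
    rw [hK, ZMod.card] at this
    exact (Nat.pow_right_injective le_rfl this).symm
  rw [FiniteField.algebraMap_trace_eq_sum_pow, hf, he, map_zero, Nat.card_zmod]
  have hper (j i : ℕ) : c ^ 2 ^ (h * j + i) = c ^ 2 ^ i := by
    induction j with
    | zero => simp
    | succ j ih => rw [mul_add, mul_one, add_assoc, add_comm h i, ← add_assoc, pow_add, mul_comm,
        pow_mul, hc, ih]
  have hsum (j : ℕ) : ∑ i ∈ Finset.range (h * j), c ^ 2 ^ i =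
      j * ∑ i ∈ Finset.range h, c ^ 2 ^ i := by
    induction j with
    | zero => simp
    | succ j ih =>
      rw [mul_add, mul_one, Finset.sum_range_add, ih]
      simp only [hper]
      push_cast
      ring
  rw [hsum, Nat.cast_mul, Nat.cast_two, CharTwo.two_eq_zero]
  ring

/-- On the radical, the subfield with `2 ^ (2 h)` elements, the form `Tr (x ^ (2 ^ h + 1))`
vanishes. -/
lemma trace_pow_eq_zero_of_pow_eq_self {e h k : ℕ} (hK : Fintype.card K = 2 ^ e)
    (he : e = h * (2 * k)) {z : K} (hz : z ^ 2 ^ (2 * h) = z) :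
    Algebra.trace (ZMod 2) K (z ^ (2 ^ h + 1)) = 0 := by
  refine trace_eq_zero_of_pow_eq_self hK he ?_
  have e : (z ^ 2 ^ h) ^ 2 ^ h = z := by rw [← pow_mul, ← pow_add, ← two_mul, hz]
  rw [pow_succ, mul_pow, e, mul_comm]

/-- The square of a `weilSum` with `a = 1`: the sum over the radical is that of an additive
character. -/
lemma weilSum_one_sq [DecidableEq K] {e h k : ℕ} (hK : Fintype.card K = 2 ^ e)
    (he : e = h * (2 * k)) (u : K) :
    weilSum h 1 u ^ 2 =
      Fintype.card K * ∑ z with z ^ 2 ^ (2 * h) = z, traceChar K (u * z) := by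
  simp only [weilSum_sq, one_mul, one_pow, eq_comm (b := _ ^ 2 ^ (2 * h))]
  congr 1
  refine Finset.sum_congr rfl fun z hz => ?_
  rw [AddChar.map_add_eq_mul, traceChar_apply (z ^ _),
    if_pos (trace_pow_eq_zero_of_pow_eq_self hK he (Finset.mem_filter.1 hz).2), one_mul]

lemma weilSum_one_zero_sq {e h k : ℕ} (hh : 0 < h) (hK : Fintype.card K = 2 ^ e)
    (he : e = h * (2 * k)) : weilSum (K := K) h 1 0 ^ 2 = Fintype.card K * 2 ^ (2 * h) := by
  classical
  rw [weilSum_one_sq hK he]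
  simp [card_radical hh hK he]

lemma weilSum_one_eq_zero_or_sq {e h k : ℕ} (hh : 0 < h) (hK : Fintype.card K = 2 ^ e)
    (he : e = h * (2 * k)) (u : K) :
    weilSum h 1 u = 0 ∨ weilSum h 1 u ^ 2 = Fintype.card K * 2 ^ (2 * h) := by
  classical
  have := charP_two_of_algebra K
  let W : AddSubgroup K :=
    (iterateFrobenius K 2 (2 * h)).toAddMonoidHom.eqLocus (AddMonoidHom.id K)
  have hW : ∑ z with z ^ 2 ^ (2 * h) = z, traceChar K (u * z) =
      ∑ w : W, ((traceChar K).mulShift u).compAddMonoidHom W.subtype w :=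
    Finset.sum_subtype _ (fun z => by simp [W, AddMonoidHom.eqLocus, iterateFrobenius_def]) _
  have hc : Fintype.card W = 2 ^ (2 * h) := by
    rw [← card_radical hh hK he]
    exact Fintype.card_of_subtype _ fun z => by
      simp [W, AddMonoidHom.eqLocus, iterateFrobenius_def]
  rw [weilSum_one_sq hK he, hW, AddChar.sum_eq_ite]
  split_ifs with h0
  · right
    rw [hc]
    norm_cast
  · left
    rw [← sq_eq_zero_iff, weilSum_one_sq hK he, hW, AddChar.sum_eq_ite, if_neg h0, mul_zero]

lemma two_pow_mul_modEq (h j : ℕ) : (2 : ℤ) ^ (h * j) ≡ (-1) ^ j [ZMOD 2 ^ h + 1] := by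
  rw [pow_mul]
  refine Int.ModEq.pow j ?_
  exact (Int.modEq_iff_dvd.2 ⟨-1, by ring⟩)

/-- The sign of a number known up to sign is decided by its residue modulo `2 ^ h + 1 ≥ 3`. -/
lemma eq_neg_one_pow_mul {h j : ℕ} (hh : 0 < h) {s : ℤ} (hs : s ^ 2 = (2 ^ (h * j)) ^ 2)
    (hd : ((2 ^ h + 1 : ℕ) : ℤ) ∣ s - 1) : s = (-1) ^ j * 2 ^ (h * j) := by
  push_cast at hd
  have h2 : (2 : ℤ) ≤ 2 ^ h := by exact_mod_cast Nat.le_self_pow hh.ne' 2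
  have hm := (two_pow_mul_modEq h j).symm.dvd
  have hcontra : ¬ (2 : ℤ) ^ h + 1 ∣ 2 := fun h3 => by
    have := Int.le_of_dvd (by norm_num) h3
    omega
  rcases sq_eq_sq_iff_eq_or_eq_neg.1 hs with rfl | rfl <;>
    rcases neg_one_pow_eq_or ℤ j with hj | hj <;> rw [hj] at hm ⊢
  · ring
  · refine absurd ?_ hcontra
    have := dvd_sub hm hd
    ring_nf at this ⊢
    exact this
  · refine absurd ?_ hcontra
    have := dvd_add hm hd
    rw [← dvd_neg]
    ring_nf at this ⊢
    exact this
  · ring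

end SignedValues

/-! ### Weights of the codewords -/

section Weights

variable {K : Type*} [Field K] [Fintype K] [Algebra (ZMod 2) K]

lemma mem_definingSet {h : ℕ} {a : K} {p : K × K} : p ∈ definingSet h a 0 ↔
    p ≠ 0 ∧ Algebra.trace (ZMod 2) K (a * p.1 ^ (2 ^ h + 1)) = 0 := by
  simp [definingSet]

/-- The length of the code; the `+ 1` accounts for the origin, which `definingSet` leaves out. -/
lemma two_mul_card_definingSet_add_one (h : ℕ) (a : K) :
    2 * (((definingSet h a 0).card : ℤ) + 1) =
      Fintype.card K * (Fintype.card K + weilSum h a 0) := by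
  classical
  have key (p : K × K) : 2 * ((if p ∈ definingSet h a 0 then (1 : ℤ) else 0) +
      if p = 0 then 1 else 0) = 1 + traceChar K (a * p.1 ^ (2 ^ h + 1)) := by
    simp only [mem_definingSet, traceChar_apply]
    by_cases hp : p = 0
    · simp [hp]
    · by_cases ht : Algebra.trace (ZMod 2) K (a * p.1 ^ (2 ^ h + 1)) = 0 <;> simp [hp, ht]
  have h1 : (((definingSet h a 0).card : ℤ) + 1) =
      ∑ p : K × K, ((if p ∈ definingSet h a 0 then (1 : ℤ) else 0) + if p = 0 then 1 else 0) := by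
    rw [Finset.sum_add_distrib]
    simp
  rw [h1, Finset.mul_sum]
  simp only [key]
  rw [Fintype.sum_prod_type]
  simp [Finset.sum_add_distrib, weilSum, ← Finset.mul_sum]

/-- The weight of the codeword of `(u, v)`, by expanding the indicator functions of `D` and of
`Tr (u x + v y) = 1` in characters. -/
lemma four_mul_hammingNorm_codeword [DecidableEq K] (h : ℕ) (a : K) (p : K × K) :
    4 * (hammingNorm (codeword (definingSet h a 0) p) : ℤ) =
      Fintype.card K * (Fintype.card K + weilSum h a 0) -
        (if p.2 = 0 then (Fintype.card K : ℤ) else 0) *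
          ((if p.1 = 0 then (Fintype.card K : ℤ) else 0) + weilSum h a p.1) := by
  have key (d : K × K) : (if d ∈ definingSet h a 0 then
        4 * (if Algebra.trace (ZMod 2) K (p.1 * d.1 + p.2 * d.2) ≠ 0 then (1 : ℤ) else 0) else 0) =
      (1 + traceChar K (a * d.1 ^ (2 ^ h + 1))) *
        (1 - traceChar K (p.1 * d.1 + p.2 * d.2)) := by
    simp only [mem_definingSet, traceChar_apply]
    by_cases hd : d = 0
    · simp [hd]
    · by_cases ht : Algebra.trace (ZMod 2) K (a * d.1 ^ (2 ^ h + 1)) = 0 <;>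
      by_cases hu : Algebra.trace (ZMod 2) K (p.1 * d.1 + p.2 * d.2) = 0 <;>
      simp [-map_add, hd, ht, hu]
  have hw : (hammingNorm (codeword (definingSet h a 0) p) : ℤ) = ∑ d ∈ definingSet h a 0,
      if Algebra.trace (ZMod 2) K (p.1 * d.1 + p.2 * d.2) ≠ 0 then (1 : ℤ) else 0 := by
    rw [hammingNorm, Finset.card_filter, Nat.cast_sum, ← Finset.sum_coe_sort (definingSet h a 0)
      fun d => if Algebra.trace (ZMod 2) K (p.1 * d.1 + p.2 * d.2) ≠ 0 then (1 : ℤ) else 0]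
    simp [codeword]
  have expand (x y : K) : (1 + traceChar K (a * x ^ (2 ^ h + 1))) *
      (1 - traceChar K (p.1 * x + p.2 * y)) =
      (1 + traceChar K (a * x ^ (2 ^ h + 1))) -
        (traceChar K (p.1 * x) + traceChar K (a * x ^ (2 ^ h + 1) + p.1 * x)) *
          traceChar K (p.2 * y) := by
    rw [AddChar.map_add_eq_mul, AddChar.map_add_eq_mul]; ring
  rw [hw, Finset.mul_sum, ← Finset.univ_inter (definingSet h a 0), ← Finset.sum_ite_mem]
  simp only [key]
  rw [Fintype.sum_prod_type]
  simp only [expand, Finset.sum_sub_distrib, ← Finset.mul_sum, sum_traceChar_mul,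
    Finset.sum_const, ← Finset.smul_sum, ← Finset.sum_mul, Finset.sum_add_distrib]
  simp only [weilSum, Finset.card_univ, nsmul_eq_mul, mul_one, zero_mul, add_zero]
  ring

end Weights

/-! ### Counting -/

section Counting

lemma weightMultiplicity_range {V ι : Type*} [AddCommGroup V] [Module (ZMod 2) V] [Fintype V]
    [Fintype ι] {f : V →ₗ[ZMod 2] (ι → ZMod 2)} (hf : Function.Injective f) (w : ℕ) :
    weightMultiplicity (LinearMap.range f) w =
      (Finset.univ.filter fun p : V => hammingNorm (f p) = w).card := by
  have : {c : ι → ZMod 2 | c ∈ LinearMap.range f ∧ hammingNorm c = w} =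
      f '' ((Finset.univ.filter fun p : V => hammingNorm (f p) = w : Finset V) : Set V) := by
    ext c
    simp only [Set.mem_ofPred_eq, LinearMap.mem_range, Set.mem_image, Finset.coe_filter,
      Finset.mem_univ, true_and]
    constructor
    · rintro ⟨⟨p, rfl⟩, hw⟩; exact ⟨p, hw, rfl⟩
    · rintro ⟨p, hw, rfl⟩; exact ⟨⟨p, rfl⟩, hw⟩
  rw [weightMultiplicity, this, Set.ncard_image_of_injective _ hf, Set.ncard_coe_finset]

lemma card_filter_snd_eq_zero {K : Type*} [Zero K] [Fintype K] [DecidableEq K] (P : K → Prop)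
    [DecidablePred P] : (Finset.univ.filter fun p : K × K => p.2 = 0 ∧ P p.1).card =
      (Finset.univ.filter P).card := by
  have : (Finset.univ.filter fun p : K × K => p.2 = 0 ∧ P p.1) =
      (Finset.univ.filter P) ×ˢ {(0 : K)} := by
    ext p
    simp [-Finset.product_singleton, and_comm]
  rw [this, Finset.card_product, Finset.card_singleton, mul_one]

variable {K : Type*} [Field K] [Fintype K] [Algebra (ZMod 2) K]

/-- The multiplicities of the values `s` and `-s`, from the first two moments. -/
lemma card_weilSum_eq {h : ℕ} {a : K} {s t : ℤ} (hs : s ≠ 0) (hst : s * t = Fintype.card K)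
    (hval : ∀ u, weilSum h a u = 0 ∨ weilSum h a u = s ∨ weilSum h a u = -s) :
    2 * ((Finset.univ.filter fun u => weilSum h a u = s).card : ℤ) = t ^ 2 + t ∧
      2 * ((Finset.univ.filter fun u => weilSum h a u = -s).card : ℤ) = t ^ 2 - t := by
  have hne : s ≠ -s := by omega
  have h1 (u : K) : weilSum h a u =
      s * ((if weilSum h a u = s then 1 else 0) - if weilSum h a u = -s then 1 else 0) := by
    rcases hval u with hu | hu | hu <;> rw [hu] <;> simp [hs, hs.symm, hne, hne.symm]
  have h2 (u : K) : weilSum h a u ^ 2 =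
      s ^ 2 * ((if weilSum h a u = s then 1 else 0) + if weilSum h a u = -s then 1 else 0) := by
    rcases hval u with hu | hu | hu <;> rw [hu] <;> simp [hs, hs.symm, hne, hne.symm]
  have e1 := sum_weilSum h a
  rw [Finset.sum_congr rfl fun u _ => h1 u, ← Finset.mul_sum, Finset.sum_sub_distrib, ← hst,
    Finset.sum_boole, Finset.sum_boole] at e1
  have e2 := sum_weilSum_sq h a
  rw [Finset.sum_congr rfl fun u _ => h2 u, ← Finset.mul_sum, Finset.sum_add_distrib, ← hst,
    Finset.sum_boole, Finset.sum_boole, mul_pow] at e2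
  have e1' := mul_left_cancel₀ hs e1
  have e2' := mul_left_cancel₀ (pow_ne_zero 2 hs) e2
  constructor <;> linarith

/-- The code of `a` when all `weilSum h a u` are `0` or `± s`, with `s` the value at `u = 0` and
`t = q / s`. -/
theorem weightDistribution_of_weilSum {e h : ℕ} {a : K} {s t : ℤ} (hK : Fintype.card K = 2 ^ e)
    (he : 2 ≤ e) (h0 : weilSum h a 0 = s) (hst : s * t = Fintype.card K)
    (hval : ∀ u, weilSum h a u = 0 ∨ weilSum h a u = s ∨ weilSum h a u = -s)
    (hpos : 0 < Fintype.card K + 2 * s) :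
    Module.finrank (ZMod 2) (definingSetCode (definingSet h a 0)) = 2 * e ∧
      HasWeightDistribution (definingSetCode (definingSet h a 0))
        [(0, 1),
         (1 / 4 * Fintype.card K * (Fintype.card K + s), Fintype.card K ^ 2 - t ^ 2),
         (1 / 4 * Fintype.card K ^ 2, 1 / 2 * (t ^ 2 + t) - 1),
         (1 / 4 * Fintype.card K * (Fintype.card K + 2 * s), 1 / 2 * (t ^ 2 - t))] := by
  classical
  set q := Fintype.card K with hq
  have hqpos : (0 : ℤ) < q := by rw [hK]; positivity
  have hs : s ≠ 0 := by rintro rfl; omega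
  have hqs : 0 < q + s := by omega
  have hwt := four_mul_hammingNorm_codeword h a
  rw [h0, ← hq] at hwt
  set f := codeword (definingSet h a 0) with hf
  -- a codeword weight is determined by the value subtracted from `q + s`
  have hwt' (p : K × K) (c : ℤ) : 4 * (hammingNorm (f p) : ℤ) = q * (q + c) ↔
      (if p.2 = 0 then (if p.1 = 0 then (q : ℤ) else 0) + weilSum h a p.1 else 0) = s - c := by
    rw [hwt]
    have : (q : ℤ) * (q + s) - (if p.2 = 0 then (q : ℤ) else 0) *
        ((if p.1 = 0 then (q : ℤ) else 0) + weilSum h a p.1) = q * (q + s -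
        if p.2 = 0 then (if p.1 = 0 then (q : ℤ) else 0) + weilSum h a p.1 else 0) := by
      split_ifs <;> ring
    rw [this, mul_right_inj' hqpos.ne']
    constructor <;> intro h <;> linarith
  have hzero (p : K × K) : hammingNorm (f p) = 0 ↔ p = 0 := by
    have := hwt' p (-q)
    rw [show (hammingNorm (f p) = 0 ↔ 4 * (hammingNorm (f p) : ℤ) = q * (q + -q)) by
      constructor <;> intro h <;> [simp [h]; (simp at h; simpa using h)], this, Prod.ext_iff]
    have := hval p.1
    by_cases hp2 : p.2 = 0 <;> by_cases hp1 : p.1 = 0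
    · simp [hp1, hp2, h0, add_comm]
    · simp [hp1, hp2]; omega
    · simp [hp1, hp2]; omega
    · simp [hp1, hp2]; omega
  have hinj : Function.Injective f := by
    rw [injective_iff_map_eq_zero]
    intro p hp
    rw [← hzero, hp, hammingNorm_zero]
  have hmul := weightMultiplicity_range hinj
  obtain ⟨hplus, hminus⟩ := card_weilSum_eq hs hst hval
  have hrow (p : K × K) : hammingNorm (f p) = 0 ∨ 4 * (hammingNorm (f p) : ℤ) = q * (q + s) ∨
      4 * (hammingNorm (f p) : ℤ) = q * (q + 0) ∨
      4 * (hammingNorm (f p) : ℤ) = q * (q + 2 * s) := by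
    rw [hzero, hwt', hwt', hwt', Prod.ext_iff]
    by_cases hp2 : p.2 = 0
    · by_cases hp1 : p.1 = 0
      · simp [hp1, hp2]
      · have := hval p.1
        simp only [hp1, hp2, if_true, if_false]
        omega
    · simp [hp2]
  obtain ⟨q', hq'⟩ : (4 : ℤ) ∣ q := by
    rw [hK]; exact_mod_cast pow_dvd_pow 2 he
  have hex (c : ℤ) (hc : 0 < q + c) : ∃ w : ℕ, 4 * (w : ℤ) = q * (q + c) := by
    refine ⟨(q' * (q + c)).toNat, ?_⟩
    rw [Int.toNat_of_nonneg (mul_nonneg (by omega) hc.le), ← mul_assoc, ← hq']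
  have hcount (w : ℕ) (c : ℤ) (hw : 4 * (w : ℤ) = q * (q + c)) :
      weightMultiplicity (LinearMap.range f) w = (Finset.univ.filter fun p : K × K =>
        (if p.2 = 0 then (if p.1 = 0 then (q : ℤ) else 0) + weilSum h a p.1 else 0) =
          s - c).card := by
    rw [hmul]
    congr 1
    ext p
    rw [Finset.mem_filter, Finset.mem_filter, ← hwt', ← hw]
    simp
  refine ⟨?_, ?_, ?_⟩
  · have hfin : Module.finrank (ZMod 2) K = e := by
      have := Module.card_eq_pow_finrank (K := ZMod 2) (V := K)
      rw [← hq, hK, ZMod.card] at this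
      exact (Nat.pow_right_injective le_rfl this).symm
    rw [definingSetCode, LinearMap.finrank_range_of_inj hinj, Module.finrank_prod, hfin, two_mul]
  · simp only [List.forall_mem_cons, definingSetCode, ← hf]
    refine ⟨⟨0, by simp, ?_⟩, ?_, ?_, ?_, by simp⟩
    · rw [hmul]
      simp only [hzero, Finset.filter_eq', Finset.mem_univ, if_true]
      simp
    · obtain ⟨w, hw⟩ := hex s hqs
      refine ⟨w, by have : (4 * w : ℚ) = q * (q + s) := by exact_mod_cast hw
                    linarith, ?_⟩
      -- the complement consists of the `(u, 0)` with `weilSum h a u = ± s`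
      have hset : (Finset.univ.filter fun p : K × K =>
          (if p.2 = 0 then (if p.1 = 0 then (q : ℤ) else 0) + weilSum h a p.1 else 0) = s - s)ᶜ =
          (Finset.univ.filter fun p : K × K => p.2 = 0 ∧ weilSum h a p.1 = s) ∪
          (Finset.univ.filter fun p : K × K => p.2 = 0 ∧ weilSum h a p.1 = -s) := by
        ext p
        simp only [Finset.mem_compl, Finset.mem_filter, Finset.mem_univ, true_and,
          Finset.mem_union]
        have := hval p.1
        by_cases hp2 : p.2 = 0 <;> by_cases hp1 : p.1 = 0
        · simp [hp1, hp2, h0]; omega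
        · simp [hp1, hp2]; omega
        · simp [hp2]
        · simp [hp2]
      have hc := Finset.card_compl_add_card (Finset.univ.filter fun p : K × K =>
          (if p.2 = 0 then (if p.1 = 0 then (q : ℤ) else 0) + weilSum h a p.1 else 0) = s - s)
      rw [hset, ← hcount w s hw, Finset.card_union_of_disjoint,
        card_filter_snd_eq_zero (weilSum h a · = s),
        card_filter_snd_eq_zero (weilSum h a · = -s), Fintype.card_prod, ← hq] at hc
      · have hc' : (((Finset.univ.filter fun u => weilSum h a u = s).card +
          (Finset.univ.filter fun u => weilSum h a u = -s).card +
          weightMultiplicity (LinearMap.range f) w : ℤ) : ℚ) = ((q * q : ℤ) : ℚ) := by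
          congr 1; exact_mod_cast hc
        have h1 : ((2 * _ : ℤ) : ℚ) = _ := congrArg _ hplus
        have h2 : ((2 * _ : ℤ) : ℚ) = _ := congrArg _ hminus
        push_cast at hc' h1 h2
        linarith
      · rw [Finset.disjoint_filter]
        intro p _ hp1 hp2
        omega
    · obtain ⟨w, hw⟩ := hex 0 (by omega)
      refine ⟨w, by have : (4 * w : ℚ) = q * (q + 0) := by exact_mod_cast hw
                    linarith, ?_⟩
      have hset : (Finset.univ.filter fun p : K × K =>
          (if p.2 = 0 then (if p.1 = 0 then (q : ℤ) else 0) + weilSum h a p.1 else 0) = s - 0) =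
          (Finset.univ.filter fun p : K × K => p.2 = 0 ∧ weilSum h a p.1 = s).erase 0 := by
        ext p
        simp only [Finset.mem_erase, Finset.mem_filter, Finset.mem_univ, true_and, ne_eq,
          Prod.ext_iff]
        by_cases hp2 : p.2 = 0 <;> by_cases hp1 : p.1 = 0
        · simp [hp1, hp2, h0]; omega
        · simp [hp1, hp2]
        · simp [hp2, hs.symm]
        · simp [hp2, hs.symm]
      have hc := Finset.card_erase_add_one (a := (0 : K × K))
        (s := Finset.univ.filter fun p : K × K => p.2 = 0 ∧ weilSum h a p.1 = s) (by simp [h0])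
      rw [← hset, ← hcount w 0 hw, card_filter_snd_eq_zero (weilSum h a · = s)] at hc
      have h1 : ((2 * _ : ℤ) : ℚ) = _ := congrArg _ hplus
      rw [← hc] at h1
      push_cast at h1
      linarith
    · obtain ⟨w, hw⟩ := hex (2 * s) hpos
      refine ⟨w, by have : (4 * w : ℚ) = q * (q + 2 * s) := by exact_mod_cast hw
                    linarith, ?_⟩
      have hset : (Finset.univ.filter fun p : K × K =>
          (if p.2 = 0 then (if p.1 = 0 then (q : ℤ) else 0) + weilSum h a p.1 else 0) =
            s - 2 * s) =
          (Finset.univ.filter fun p : K × K => p.2 = 0 ∧ weilSum h a p.1 = -s) := by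
        ext p
        simp only [Finset.mem_filter, Finset.mem_univ, true_and]
        by_cases hp2 : p.2 = 0 <;> by_cases hp1 : p.1 = 0
        · simp [hp1, hp2, h0]; omega
        · simp [hp1, hp2]; omega
        · simp [hp2]; omega
        · simp [hp2]; omega
      have hc := hcount w (2 * s) hw
      rw [hset, card_filter_snd_eq_zero (weilSum h a · = -s)] at hc
      have h2 : ((2 * _ : ℤ) : ℚ) = _ := congrArg _ hminus
      rw [← hc] at h2
      push_cast at h2
      linarith
  · intro w hw
    simp only [List.forall_mem_cons] at hw
    obtain ⟨hw0, hw1, hw2, hw3, -⟩ := hw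
    rw [definingSetCode, hmul, Finset.card_eq_zero, Finset.filter_eq_empty_iff]
    rintro p - rfl
    rcases hrow p with hp | hp | hp | hp
    · exact hw0 (by simp [hp])
    · refine hw1 ?_
      have : (4 * hammingNorm (f p) : ℚ) = q * (q + s) := by exact_mod_cast hp
      linarith
    · refine hw2 ?_
      have : (4 * hammingNorm (f p) : ℚ) = q * (q + 0) := by exact_mod_cast hp
      linarith
    · refine hw3 ?_
      have : (4 * hammingNorm (f p) : ℚ) = q * (q + 2 * s) := by exact_mod_cast hp
      linarith

end Counting

/-! ### Values of the sums -/

section Values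

variable {K : Type*} [Field K] [Fintype K] [Algebra (ZMod 2) K]

lemma weilSum_zero_of_not_pow {e h k : ℕ} (hh : 0 < h) (hK : Fintype.card K = 2 ^ e)
    (he : e = h * (2 * k)) {a : K} (ha : ∀ b : K, a ≠ b ^ (2 ^ h + 1)) :
    weilSum h a 0 = (-1) ^ k * 2 ^ (h * k) := by
  refine eq_neg_one_pow_mul hh ?_ (dvd_weilSum_zero_sub_one (hK ▸ two_pow_add_one_dvd he) a)
  rw [weilSum_sq_of_not_pow ha, hK, he]
  push_cast
  rw [← pow_mul]
  ring_nf

lemma weilSum_zero_of_pow {e h k : ℕ} (hh : 0 < h) (hK : Fintype.card K = 2 ^ e)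
    (he : e = h * (2 * k)) {b : K} (hb : b ≠ 0) :
    weilSum h (b ^ (2 ^ h + 1)) 0 = (-1) ^ (k + 1) * 2 ^ (h * (k + 1)) := by
  refine eq_neg_one_pow_mul hh ?_ (dvd_weilSum_zero_sub_one (hK ▸ two_pow_add_one_dvd he) _)
  rw [← one_mul (b ^ _), weilSum_pow_mul h hb, zero_div, weilSum_one_zero_sq hh hK he, hK, he]
  push_cast
  rw [← pow_mul, ← pow_add]
  ring_nf

end Values

/-! ### The two cases -/

theorem theorem2 {K : Type*} [Field K] [Fintype K] [Algebra (ZMod 2) K]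
    (e h m q : ℕ) (hq : q = 2 ^ e) (hK : Fintype.card K = q)
    (hh : h ∈ e.properDivisors) (heven : Even (e / h)) (hm : m = e / 2)
    (g : Kˣ) (hg : ∀ x : Kˣ, x ∈ Subgroup.zpowers g) (a : Kˣ) :
    (a ∉ Subgroup.zpowers (g ^ (2 ^ h + 1)) →
      ((definingSet h (a : K) 0).card : ℚ) = 1 / 2 * q * (q + (-1) ^ (m / h) * 2 ^ m) - 1 ∧
      (e ≠ 2 →
        Module.finrank (ZMod 2) (definingSetCode (definingSet h (a : K) 0)) = 2 * e ∧
        HasWeightDistribution (definingSetCode (definingSet h (a : K) 0))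
          [(0, 1),
           (1 / 4 * q * (q + (-1) ^ (m / h) * 2 ^ m), q * (q - 1)),
           (1 / 4 * q ^ 2, 1 / 2 * q + (-1) ^ (m / h) * 2 ^ ((m : ℤ) - 1) - 1),
           (1 / 4 * q * (q + (-1) ^ (m / h) * 2 ^ (m + 1)),
              1 / 2 * q - (-1) ^ (m / h) * 2 ^ ((m : ℤ) - 1))])) ∧
    (a ∈ Subgroup.zpowers (g ^ (2 ^ h + 1)) →
      ((definingSet h (a : K) 0).card : ℚ) =
        1 / 2 * q * (q - (-1) ^ (m / h) * 2 ^ (m + h)) - 1 ∧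
      (¬ (e = 4 ∧ h = 1) →
        Module.finrank (ZMod 2) (definingSetCode (definingSet h (a : K) 0)) = 2 * e ∧
        HasWeightDistribution (definingSetCode (definingSet h (a : K) 0))
          [(0, 1),
           (1 / 4 * q * (q - (-1) ^ (m / h) * 2 ^ (m + h)),
              q ^ 2 - 2 ^ ((e : ℤ) - 2 * h)),
           (1 / 4 * q ^ 2,
              2 ^ ((e : ℤ) - 2 * h - 1) - (-1) ^ (m / h) * 2 ^ ((m : ℤ) - h - 1) - 1),
           (1 / 4 * q * (q - (-1) ^ (m / h) * 2 ^ (m + h + 1)),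
              2 ^ ((e : ℤ) - 2 * h - 1) + (-1) ^ (m / h) * 2 ^ ((m : ℤ) - h - 1))])) := by
  obtain ⟨⟨c, hc⟩, hlt⟩ := Nat.mem_properDivisors.1 hh
  have hpos : 0 < h := by rcases Nat.eq_zero_or_pos h with rfl | h0 <;> omega
  rw [hc, Nat.mul_div_cancel_left _ hpos] at heven
  obtain ⟨k, hk⟩ := heven
  have he : e = h * (2 * k) := by rw [hc, hk, two_mul]
  have hmk : m = h * k := by rw [hm, he, show h * (2 * k) = 2 * (h * k) by ring]; omega
  have hmh : m / h = k := by rw [hmk, Nat.mul_div_cancel_left _ hpos]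
  have he2 : e = 2 * m := by rw [he, hmk]; ring
  have hk1 : 1 ≤ k := by rcases Nat.eq_zero_or_pos k with rfl | h0 <;> omega
  have hhm : h ≤ m := hmk ▸ Nat.le_mul_of_pos_right h hk1
  rw [hmh]
  have hKe : Fintype.card K = 2 ^ e := hK.trans hq
  have hqm : (q : ℤ) = 2 ^ m * 2 ^ m := by rw [hq, he2]; push_cast; ring
  have hqQ : (q : ℚ) = 2 ^ m * 2 ^ m := by exact_mod_cast hqm
  have hcard := two_mul_card_definingSet_add_one h (a : K)
  have hsgn := neg_one_pow_eq_or ℤ k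
  have hsq : ((-1 : ℚ) ^ k) ^ 2 = 1 := by rw [← pow_mul, mul_comm, pow_mul]; norm_num
  have hmem (ha : a ∉ Subgroup.zpowers (g ^ (2 ^ h + 1))) (b : K) :
      (a : K) ≠ b ^ (2 ^ h + 1) := by
    intro hb
    have hb0 : b ≠ 0 := by rintro rfl; simp at hb
    obtain ⟨n, hn⟩ := Subgroup.mem_zpowers_iff.1 (hg (Units.mk0 b hb0))
    refine ha (Subgroup.mem_zpowers_iff.2 ⟨n, ?_⟩)
    rw [← zpow_natCast, zpow_comm, hn, zpow_natCast]
    ext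
    rw [hb]
    simp
  refine ⟨fun ha => ?_, fun ha => ?_⟩
  · have h0 := weilSum_zero_of_not_pow hpos hKe he (hmem ha)
    rw [← hmk] at h0
    rw [h0, hK] at hcard
    refine ⟨?_, fun hne => ?_⟩
    · have : (2 * ((definingSet h (a : K) 0).card + 1) : ℚ) = q * (q + (-1) ^ k * 2 ^ m) := by
        exact_mod_cast hcard
      linarith
    · have key := weightDistribution_of_weilSum (t := (-1) ^ k * 2 ^ m) hKe (by omega) h0 ?_ ?_ ?_
      · refine ⟨key.1, ?_⟩
        convert key.2 using 1
        rw [hK, zpow_sub₀ two_ne_zero, zpow_natCast, zpow_one]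
        push_cast
        rw [mul_pow, hsq, hqQ]
        ring_nf
      · rw [hK, hqm]
        rcases hsgn with h1 | h1 <;> rw [h1] <;> ring
      · intro u
        right
        rw [← sq_eq_sq_iff_eq_or_eq_neg, weilSum_sq_of_not_pow (hmem ha), hK, hqm]
        rcases hsgn with h1 | h1 <;> rw [h1] <;> ring
      · rw [hK, hqm]
        have h4 : (2 : ℤ) ^ 2 ≤ 2 ^ m := pow_le_pow_right₀ (by norm_num) (by omega)
        rcases hsgn with h1 | h1 <;> rw [h1] <;> nlinarith
  · obtain ⟨n, hn⟩ := Subgroup.mem_zpowers_iff.1 ha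
    have hb : (a : K) = ((g ^ n : Kˣ) : K) ^ (2 ^ h + 1) := by
      rw [← hn, ← Units.val_pow_eq_pow_val]
      congr 1
      rw [← zpow_natCast, ← zpow_natCast, zpow_comm]
    have hb0 : ((g ^ n : Kˣ) : K) ≠ 0 := Units.ne_zero _
    have h0 := weilSum_zero_of_pow hpos hKe he hb0
    have hmh1 : h * (k + 1) = m + h := by rw [hmk]; ring
    rw [← hb, hmh1] at h0
    rw [h0, hK] at hcard
    obtain ⟨d, rfl⟩ := Nat.exists_eq_add_of_le hhm
    refine ⟨?_, fun hne => ?_⟩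
    · have : (2 * ((definingSet h (a : K) 0).card + 1) : ℚ) =
          q * (q + (-1) ^ (k + 1) * 2 ^ (h + d + h)) := by
        exact_mod_cast hcard
      rw [pow_succ] at this
      linarith
    · have key := weightDistribution_of_weilSum (t := (-1) ^ (k + 1) * 2 ^ d) hKe (by omega) h0
        ?_ ?_ ?_
      · refine ⟨key.1, ?_⟩
        convert key.2 using 1
        have e1 : (2 : ℚ) ^ ((e : ℤ) - 2 * h) = 2 ^ d * 2 ^ d := by
          rw [← pow_add, ← zpow_natCast]; congr 1; rw [he2]; push_cast; ring
        have e2 : (2 : ℚ) ^ (((h + d : ℕ) : ℤ) - h - 1) = 2 ^ d / 2 := by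
          rw [zpow_sub₀ two_ne_zero, zpow_one, ← zpow_natCast]; congr 2; push_cast; ring
        rw [hK, zpow_sub₀ two_ne_zero _ 1, e1, e2, zpow_one]
        push_cast
        rw [mul_pow, pow_succ _ k, mul_pow, hsq]
        ring_nf
      · rw [hK, hqm]
        rcases hsgn with h1 | h1 <;> rw [pow_succ, h1] <;> ring
      · intro u
        rw [hb, ← one_mul (_ ^ _), weilSum_pow_mul h hb0]
        refine (weilSum_one_eq_zero_or_sq hpos hKe he _).imp_right fun hu => ?_
        rw [← sq_eq_sq_iff_eq_or_eq_neg, hu, hK, hqm]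
        rcases hsgn with h1 | h1 <;> rw [pow_succ _ k, h1] <;> ring
      · rw [hK, hqm]
        have hp : (0 : ℤ) < 2 ^ (h + d) := by positivity
        rcases Nat.even_or_odd k with hev | hodd
        · -- `k ≥ 2` gives `h ≤ d`, and `h = d = 1` is the excluded case
          have hk2 : 2 ≤ k := by obtain ⟨r, rfl⟩ := hev; omega
          have hd2 : 2 ≤ d := by
            have : h * 2 ≤ h * k := Nat.mul_le_mul_left h hk2
            by_contra hlt2
            have : h = 1 := by omega
            exact hne ⟨by omega, this⟩
          have h4 : (2 : ℤ) ^ 2 ≤ 2 ^ d := pow_le_pow_right₀ (by norm_num) hd2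
          have hp2 : (0 : ℤ) < 2 ^ (h + d) * 2 ^ h := by positivity
          rw [hev.add_one.neg_one_pow, pow_add _ (h + d) h]
          have : (2 : ℤ) ^ (h + d) * 2 ^ (h + d) = 2 ^ (h + d) * 2 ^ h * 2 ^ d := by ring
          rw [this]
          nlinarith
        · rw [hodd.add_one.neg_one_pow]
          positivity
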